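/- Let $X$ be a complex manifold of dimension $n$ (Hausdorff, second countable), and let $\Omega\Subset X$ be a relatively compact domain with $\mathcal C^3$-smooth Levi-flat boundary $M=\partial\Omega$; that is, near each point of $M$ one has $\Omega=\{\rho>0\}$ for a $\mathcal C^3$ function $\rho$ with $d\rho\neq0$, and the Levi form of $\rho$ vanishes on $TM\cap J\,TM$, where $J$ is the complex structure of $X$. A ($\mathcal C^3$-smooth) *boundary distance function* of $\Omega$ is a function $\delta:\overline\Omega\to\mathbb R$ of class $\mathcal C^3$ up to the boundary (i.e. extending to a $\mathcal C^3$ function on a neighbourhood of $\overline\Omega$), with $\Omega=\{\delta>0\}$ and $d\delta\ne 0$ on $M$. Its *Diederich–Fornaess exponent* $\eta_\delta$ is the supremum of those $\eta\in(0,1)$ for which there are a compact set $K\subset\Omega$ and a hermitian metric $g$ on $X$ with $$ i\partial\overline\partial(-\delta^{\eta})\ \ge\ \delta^{\eta} g\quad\text{on }\Omega\setminus K , $$ and $\eta_\delta=0$ if there is no such $\eta$. (A hermitian metric is smooth and is identified with its fundamental $(1,1)$-form.) A *foliated chart* of $M$ is given by an injective $\mathcal C^3$ immersion $\varphi:V\to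 M$, $(z',t)\mapsto\varphi(z',t)$, with $V\subset\mathbb C^{n-1}\times\mathbb R$ open, holomorphic in $z'$; the slices $t=\mathrm{const}$ are mapped into the leaves of the Levi foliation $\mathcal F$, whose tangent bundle $T\mathcal F=TM\cap J\,TM$ is identified with $T^{1,0}M$. A ($\mathcal C^2$-smooth) hermitian metric $h$ of the normal bundle $N^{1,0}=\mathbb C\otimes(TM/T\mathcal F)$ is a norm on each fibre of $TM/T\mathcal F$ whose representing function $h(z',t)=h(\varphi_*\tfrac{\partial}{\partial t})>0$ is of class $\mathcal C^2$ in every foliated chart. Its *Chern curvature along the leaves* is $$ i\Theta_h=-i\sum_{j,k=1}^{n-1}\frac{\partial^2\log h(z',t)}{\partial z_j\,\partial\overline z_k}\,dz_j\wedge d\overline z_k , $$ and $N^{1,0}$ is *positive along the leaves* if for some such $h$ the form $i\Theta_h$ is positive definite on $T^{1,0}M$ at every point of every foliated chart. Suppose that $\delta$ is a $\mathcal C^3$-smooth boundary distance function of $\Omega$ with $\eta_\delta>0$. Then $h_\delta(v):=|(Jv)\delta|$, $v\in TM$, is a $\mathcal C^2$-smooth hermitian metric of $N^{1,0}$, and there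 is a hermitian metric $\omega$ on $X$ such that $$ i\Theta_{h_\delta}\ \ge\ \omega|_{T^{1,0}M} $$ at every point of every foliated chart of $M$. In particular, $N^{1,0}$ is positive along the leaves. -/

import Mathlib

open scoped Manifold ContDiff Topology

noncomputable section

namespace LeviFlat

/-- A complex manifold is a real-analytic manifold for the same atlas. -/
instance isManifold_real {E X : Type*} [NormedAddCommGroup E] [NormedSpace ℂ E]
    [TopologicalSpace X] [ChartedSpace E X] [IsManifold 𝓘(ℂ, E) ω X] :
    IsManifold 𝓘(ℝ, E) ω X := by
  refine isManifold_of_contDiffOn _ _ _ fun e e' he he' => ?_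
  have h := (contDiffGroupoid ω 𝓘(ℂ, E)).compatible he he'
  rw [contDiffGroupoid, mem_groupoid_of_pregroupoid] at h
  exact ContDiffOn.restrict_scalars ℝ h.1

/-- The Levi form (complex Hessian) of a real function on a complex vector space:
`∑ ∂²f/∂z_j∂z̄_k (z) v_j v̄_k = (D²f_z(v, v) + D²f_z(iv, iv)) / 4`. -/
def leviForm {G : Type*} [NormedAddCommGroup G] [NormedSpace ℂ G]
    (f : G → ℝ) (z v : G) : ℝ :=
  (fderiv ℝ (fderiv ℝ f) z v v
    + fderiv ℝ (fderiv ℝ f) z (Complex.I • v) (Complex.I • v)) / 4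

section Manifold

variable {E : Type*} [NormedAddCommGroup E] [NormedSpace ℂ E]
  {X : Type*} [TopologicalSpace X] [ChartedSpace E X]

/-- The Levi form of a real function on a complex manifold, on the tangent space at `x`.
As everywhere in Mathlib, `T_x X` is identified with the model space `E` by the preferred
(holomorphic) chart at `x`; the form does not depend on the chart. -/
def mleviForm (u : X → ℝ) (x : X) (v : E) : ℝ :=
  leviForm (fun z => u ((chartAt E x).symm z)) (chartAt E x x) v

/-- The differential `dδ_x : T_x X → ℝ`. -/
def dif (δ : X → ℝ) (x : X) : E →L[ℝ] ℝ := mfderiv 𝓘(ℝ, E) 𝓘(ℝ, ℝ) δ x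

variable (E X) in
/-- A smooth hermitian metric on a complex manifold, given by its real part: a smooth
Riemannian metric for which the complex structure `J` (multiplication by `i`) is orthogonal. -/
structure HermitianMetric [IsManifold 𝓘(ℂ, E) ω X] extends
    Bundle.ContMDiffRiemannianMetric 𝓘(ℝ, E) ∞ E
      (fun x : X => TangentSpace 𝓘(ℝ, E) x) where
  J_orthogonal : ∀ (x : X) (v w : E),
    inner x (Complex.I • v : E) (Complex.I • w : E) = inner x v w

/-- The value `g_x(v, v)` of the quadratic form of a hermitian metric. -/
def HermitianMetric.sq [IsManifold 𝓘(ℂ, E) ω X] (g : HermitianMetric E X) (x : X) (v : E) : ℝ :=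
  g.inner x v v

variable (E) in
/-- The open set `Ω` has `C³`-smooth Levi-flat boundary: near each boundary point, `Ω` is given
by `ρ > 0` for a `C³`-smooth function `ρ` with non-vanishing differential, and the Levi form of
`ρ` vanishes on the complex tangent spaces `T_x ∂Ω ∩ J T_x ∂Ω` of the boundary. -/
def HasLeviFlatBoundary (Ω : Set X) : Prop :=
  ∀ p ∈ frontier Ω, ∃ (U : Set X) (ρ : X → ℝ), IsOpen U ∧ p ∈ U ∧
    ContMDiffOn 𝓘(ℝ, E) 𝓘(ℝ, ℝ) 3 ρ U ∧
    (∀ x ∈ U, dif (E := E) ρ x ≠ 0) ∧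
    (∀ x ∈ U, x ∈ Ω ↔ 0 < ρ x) ∧
    ∀ x ∈ U ∩ frontier Ω, ∀ v : E,
      dif ρ x v = 0 → dif ρ x (Complex.I • v) = 0 → mleviForm ρ x v = 0

variable (E) in
/-- `δ` is a `C³`-smooth boundary distance function of `Ω`: a function that is `C³`-smooth on the
closure of `Ω` (i.e. on a neighbourhood of it; only its values on the closure matter), with
`Ω = {δ > 0}` in the closure of `Ω` and `dδ ≠ 0` on the boundary. -/
structure IsBoundaryDistance (Ω : Set X) (δ : X → ℝ) : Prop where
  smooth : ∃ U : Set X, IsOpen U ∧ closure Ω ⊆ U ∧ ContMDiffOn 𝓘(ℝ, E) 𝓘(ℝ, ℝ) 3 δ U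
  pos_iff : ∀ x ∈ closure Ω, x ∈ Ω ↔ 0 < δ x
  dif_ne_zero : ∀ x ∈ frontier Ω, dif (E := E) δ x ≠ 0

variable (E) in
/-- `-δ^η` is strictly plurisubharmonic on `Ω` outside a compact subset, in the quantitative form
`i∂∂̄(-δ^η) ≥ δ^η g` there, for some hermitian metric `g` on `X`. (On every compact subset of `Ω`
this is the same as positivity of the complex Hessian; the metric `g` prevents the strictness
relative to `δ^η` from being lost at the boundary.) -/
def StrictlyPSHNearBoundary [IsManifold 𝓘(ℂ, E) ω X] (Ω : Set X) (δ : X → ℝ) (η : ℝ) : Prop :=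
  ∃ (K : Set X) (g : HermitianMetric E X), IsCompact K ∧ K ⊆ Ω ∧
    ∀ x ∈ Ω \ K, ∀ v : E, δ x ^ η * g.sq x v ≤ mleviForm (fun y => -(δ y ^ η)) x v

variable (E) in
/-- The Diederich–Fornaess exponent (in the weak sense) of `δ`; it is `0` if there is no
admissible `η` (the supremum of the empty set of reals is `0` in Mathlib). -/
def dfExponent [IsManifold 𝓘(ℂ, E) ω X] (Ω : Set X) (δ : X → ℝ) : ℝ :=
  sSup {η : ℝ | 0 < η ∧ η < 1 ∧ StrictlyPSHNearBoundary E Ω δ η}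

variable {F : Type*} [NormedAddCommGroup F] [NormedSpace ℂ F]

/-- The real differential `φ_* : F × ℝ → T_{φ q} X`. -/
def push (φ : F × ℝ → X) (q : F × ℝ) : F × ℝ →L[ℝ] E :=
  mfderiv 𝓘(ℝ, F × ℝ) 𝓘(ℝ, E) φ q

variable (E) in
/-- `φ : V → M` is the parametrization of a foliated chart of the Levi foliation of the Levi-flat
hypersurface `M`, where `V ⊆ ℂⁿ⁻¹ × ℝ` is open (`F` stands for `ℂⁿ⁻¹`): an injective
`C³`-smooth immersion `φ(z', t)`, holomorphic in `z'`. For dimension reasons its image is open in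
`M`, it is a homeomorphism onto its image, and it maps the slices `t = const` into leaves. -/
structure IsFoliatedParam (M : Set X) (V : Set (F × ℝ)) (φ : F × ℝ → X) : Prop where
  isOpen : IsOpen V
  smooth : ContMDiffOn 𝓘(ℝ, F × ℝ) 𝓘(ℝ, E) 3 φ V
  mapsTo : Set.MapsTo φ V M
  injOn : Set.InjOn φ V
  immersion : ∀ q ∈ V, Function.Injective (push (E := E) φ q)
  holomorphic : ∀ q ∈ V, ∀ w : F,
    push (E := E) φ q (Complex.I • w, 0) = Complex.I • push (E := E) φ q (w, 0)

/-- The function `h(z', t) = h(φ_* ∂/∂t)` which represents a metric `h` of the normal bundle in a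
foliated chart. -/
def coeff (h : X → E → ℝ) (φ : F × ℝ → X) (q : F × ℝ) : ℝ :=
  h (φ q) (push φ q (0, 1))

variable (F) in
/-- `h` is a `C²`-smooth hermitian metric of the normal bundle `N^{1,0} = ℂ ⊗ (TM / T𝓕)`. Here
`h x v` is the norm (not its square) of the class of `v ∈ T_x M`, so that
`h(φ_*(w + s ∂/∂t)) = |s| h(φ_* ∂/∂t)` with `h(φ_* ∂/∂t) > 0` in every foliated chart.
Values of `h` outside `TM` are irrelevant. -/
def IsNormalMetric (M : Set X) (h : X → E → ℝ) : Prop :=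
  ∀ (V : Set (F × ℝ)) (φ : F × ℝ → X), IsFoliatedParam E M V φ →
    (∀ q ∈ V, ∀ (w : F) (s : ℝ), h (φ q) (push φ q (w, s)) = |s| * coeff h φ q) ∧
    (∀ q ∈ V, 0 < coeff h φ q) ∧
    ContDiffOn ℝ 2 (coeff h φ) V

/-- The Chern curvature `iΘ_h = -i ∂_b ∂̄_b log h` along the leaves, in a foliated chart `φ`, as a
quadratic form in the tangent vector `φ_* w` of the leaf. -/
def chernCurvature (h : X → E → ℝ) (φ : F × ℝ → X) (q : F × ℝ) (w : F) : ℝ :=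
  leviForm (fun z : F => -Real.log (coeff h φ (z, q.2))) q.1 w

variable (E F) in
/-- The normal bundle of `M` is positive along the leaves. -/
def PositiveAlongLeaves (M : Set X) : Prop :=
  ∃ h : X → E → ℝ, IsNormalMetric F M h ∧
    ∀ (V : Set (F × ℝ)) (φ : F × ℝ → X), IsFoliatedParam E M V φ →
      ∀ q ∈ V, ∀ w : F, w ≠ 0 → 0 < chernCurvature h φ q w

/-- The metric `h_δ` of the normal bundle induced by `δ`: `h_δ(v) = |(J v) δ|` for `v ∈ TM`. -/
def hMetric (δ : X → ℝ) (x : X) (v : E) : ℝ := |dif δ x (Complex.I • v)|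

end Manifold

end LeviFlat

end

/-! Fix a leaf direction `w` at a boundary point. The leaf contains a holomorphic disc `a` with
velocity `φ_* w`, and `b = ± i ∂φ/∂t` is holomorphic along it, being up to a constant the
`t`-derivative of a family of holomorphic maps. With the right sign, `b` points into `Ω`, and `h_δ =
dδ(b)` along the disc. The discs `a + s b` with small `s > 0` have centres in `Ω` outside `K`, so
the hypothesis on `-δ^η` applies there.

Put `u(z, s) = δ(a z + s b z)`. Since `u(z, 0) = 0`, the quotients `u / s` tend to `h_δ` as `s →
0⁺`, together with their first and second derivatives in `z`. Dividing the inequality by `δ^η` and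
letting `s → 0⁺` gives `g ≤ -η A + η (1 - η) B`, where `A` is the Levi form of `h_δ` over `h_δ` and
`B` is `|∂h_δ|² / h_δ²`. The curvature is `-A + B`. Hence `g ≤ η (-A + B)`, so the curvature is
nonnegative, and `η < 1` yields `g ≤ -A + B`. A single admissible `η` suffices, and the metric `g`
that comes with it serves as `ω`.

The limit is `le_leviForm_neg_log_of_disc`. `apply_I_smul_ne_zero` gives transversality,
`mleviForm_chartDeriv` reduces to one chart, and `sq_push_le_chernCurvature` assembles the argument.
-/

open Filter

namespace LeviFlat


/-! ### Second derivatives, chain rules for the Levi form, and limits of difference quotients. -/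

section Calculus

variable {G H : Type*} [NormedAddCommGroup G] [NormedAddCommGroup H]

theorem fderiv_fderiv_apply [NormedSpace ℝ G] [NormedSpace ℝ H] {f : G → H} {z : G}
    (hf : ContDiffAt ℝ 2 f z) (v w : G) :
    fderiv ℝ (fderiv ℝ f) z w v = fderiv ℝ (fun y => fderiv ℝ f y v) z w := by
  have h : DifferentiableAt ℝ (fderiv ℝ f) z :=
    (hf.fderiv_right (m := 1) (by norm_num)).differentiableAt (by norm_num)
  have := (h.hasFDerivAt.clm_apply (hasFDerivAt_const v z)).fderiv
  rw [this]; simp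

theorem fderiv_fderiv_comm [NormedSpace ℝ G] [NormedSpace ℝ H] {f : G → H} {z : G}
    (hf : ContDiffAt ℝ 2 f z) (v w : G) :
    fderiv ℝ (fderiv ℝ f) z v w = fderiv ℝ (fderiv ℝ f) z w v :=
  (hf.isSymmSndFDerivAt (by simp)).eq v w

theorem contDiffAt_fderiv_apply [NormedSpace ℝ G] [NormedSpace ℝ H] {f : G → H} {z : G}
    {n m : WithTop ℕ∞} (hf : ContDiffAt ℝ n f z) (hmn : m + 1 ≤ n) (v : G) :
    ContDiffAt ℝ m (fun y => fderiv ℝ f y v) z :=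
  (hf.fderiv_right hmn).clm_apply contDiffAt_const

theorem fderiv_fderiv_comp [NormedSpace ℝ G] [NormedSpace ℝ H] {K : Type*}
    [NormedAddCommGroup K] [NormedSpace ℝ K] {f : H → K} {Φ : G → H} {z : G}
    (hf : ContDiffAt ℝ 2 f (Φ z)) (hΦ : ContDiffAt ℝ 2 Φ z) (v : G) :
    fderiv ℝ (fderiv ℝ fun y => f (Φ y)) z v v =
      fderiv ℝ (fderiv ℝ f) (Φ z) (fderiv ℝ Φ z v) (fderiv ℝ Φ z v) +
        fderiv ℝ f (Φ z) (fderiv ℝ (fderiv ℝ Φ) z v v) := by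
  have hev : (fun y => fderiv ℝ (fun y => f (Φ y)) y v) =ᶠ[𝓝 z]
      fun y => fderiv ℝ f (Φ y) (fderiv ℝ Φ y v) := by
    filter_upwards [hΦ.continuousAt.eventually (hf.eventually (by simp)),
      hΦ.eventually (by simp)] with y h1 h2
    have := ((h1.differentiableAt (by norm_num)).hasFDerivAt.comp y
      (h2.differentiableAt (by norm_num)).hasFDerivAt).fderiv
    rw [show (fun y => f (Φ y)) = f ∘ Φ from rfl, this]; rfl
  rw [fderiv_fderiv_apply (f := fun y => f (Φ y)) (hf.comp z hΦ), hev.fderiv_eq]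
  have hf1 : DifferentiableAt ℝ (fderiv ℝ f) (Φ z) :=
    (hf.fderiv_right (m := 1) (by norm_num)).differentiableAt (by norm_num)
  have hΦ1 : DifferentiableAt ℝ (fun y => fderiv ℝ Φ y v) z :=
    (contDiffAt_fderiv_apply hΦ (m := 1) (by norm_num) v).differentiableAt (by norm_num)
  have hΦ0 := hΦ.differentiableAt (by norm_num)
  have := ((hf1.hasFDerivAt.comp z hΦ0.hasFDerivAt).clm_apply hΦ1.hasFDerivAt).fderiv
  rw [show (fun y => (fderiv ℝ f (Φ y)) (fderiv ℝ Φ y v)) =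
    fun y => ((fderiv ℝ f ∘ Φ) y) (fderiv ℝ Φ y v) from rfl, this, fderiv_fderiv_apply hΦ]
  simp [add_comm]

theorem leviForm_congr [NormedSpace ℂ G] {f k : G → ℝ} {z : G} (h : f =ᶠ[𝓝 z] k) (v : G) :
    leviForm f z v = leviForm k z v := by
  unfold leviForm
  rw [h.fderiv.fderiv_eq]

/-- The chain rule leaves the extra terms `df(D²Φ(v, v)) + df(D²Φ(iv, iv))`. They cancel, because a
differential that is complex linear near `z` makes `D²Φ` complex bilinear. -/
theorem leviForm_comp_holomorphic [NormedSpace ℂ G] [NormedSpace ℂ H] {f : H → ℝ} {Φ : G → H}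
    {z : G} (hf : ContDiffAt ℝ 2 f (Φ z)) (hΦ : ContDiffAt ℝ 2 Φ z)
    (hJ : ∀ᶠ y in 𝓝 z, ∀ v, fderiv ℝ Φ y (Complex.I • v) = Complex.I • fderiv ℝ Φ y v) (v : G) :
    leviForm (fun y => f (Φ y)) z v = leviForm f (Φ z) (fderiv ℝ Φ z v) := by
  have hI : ∀ v w, fderiv ℝ (fderiv ℝ Φ) z w (Complex.I • v) =
      Complex.I • fderiv ℝ (fderiv ℝ Φ) z w v := by
    intro v w
    have hev : (fun y => fderiv ℝ Φ y (Complex.I • v)) =ᶠ[𝓝 z]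
        fun y => Complex.I • fderiv ℝ Φ y v := hJ.mono fun y hy => hy v
    have hd : DifferentiableAt ℝ (fun y => fderiv ℝ Φ y v) z :=
      (contDiffAt_fderiv_apply hΦ (m := 1) (by norm_num) v).differentiableAt (by norm_num)
    rw [fderiv_fderiv_apply hΦ, fderiv_fderiv_apply hΦ, hev.fderiv_eq, fderiv_fun_const_smul hd]
    rfl
  have h2 : fderiv ℝ (fderiv ℝ Φ) z (Complex.I • v) (Complex.I • v) =
      -fderiv ℝ (fderiv ℝ Φ) z v v := by
    rw [hI, fderiv_fderiv_comm hΦ, hI, smul_smul, Complex.I_mul_I, neg_one_smul]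
  unfold leviForm
  rw [fderiv_fderiv_comp hf hΦ, fderiv_fderiv_comp hf hΦ, h2, hJ.self_of_nhds v, map_neg]
  ring

theorem leviForm_comp_real [NormedSpace ℂ G] {k : G → ℝ} {χ χ₁ : ℝ → ℝ} {c : ℝ} {z : G}
    (hk : ContDiffAt ℝ 2 k z) (hχ : ∀ᶠ x in 𝓝 (k z), HasDerivAt χ (χ₁ x) x)
    (hχ₁ : HasDerivAt χ₁ c (k z)) (v : G) :
    leviForm (fun y => χ (k y)) z v = χ₁ (k z) * leviForm k z v +
      c * ((fderiv ℝ k z v ^ 2 + fderiv ℝ k z (Complex.I • v) ^ 2) / 4) := by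
  have hk0 := hk.differentiableAt (by norm_num)
  have hk1 : DifferentiableAt ℝ (fderiv ℝ k) z :=
    (hk.fderiv_right (m := 1) (by norm_num)).differentiableAt (by norm_num)
  have hev : (fderiv ℝ fun y => χ (k y)) =ᶠ[𝓝 z] fun y => χ₁ (k y) • fderiv ℝ k y := by
    filter_upwards [hk.continuousAt.eventually hχ, hk.eventually (by simp)] with y h1 h2
    exact (h1.comp_hasFDerivAt y (h2.differentiableAt (by norm_num)).hasFDerivAt).fderiv
  have hd : HasFDerivAt (fun y => χ₁ (k y)) (c • fderiv ℝ k z) z :=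
    hχ₁.comp_hasFDerivAt z hk0.hasFDerivAt
  have h := (hd.smul hk1.hasFDerivAt).fderiv
  unfold leviForm
  rw [hev.fderiv_eq]
  erw [h]
  simp
  ring

/-! ### Dividing by a parameter a function which vanishes at parameter `0` -/

theorem fderiv_slice [NormedSpace ℝ G] {u : G × ℝ → ℝ} {z : G} {s : ℝ}
    (hu : DifferentiableAt ℝ u (z, s)) (v : G) :
    fderiv ℝ (fun y => u (y, s)) z v = fderiv ℝ u (z, s) (v, 0) := by
  have := (HasFDerivAt.comp (g := u) (f := fun y : G => (y, s)) z hu.hasFDerivAt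
    ((hasFDerivAt_id (𝕜 := ℝ) z).prodMk (hasFDerivAt_const s z))).fderiv
  rw [show (fun y => u (y, s)) = u ∘ (fun y => (y, s)) from rfl, this]; simp

theorem eventually_slice {P : G × ℝ → Prop} {z : G} {s : ℝ} (h : ∀ᶠ p in 𝓝 (z, s), P p) :
    ∀ᶠ y in 𝓝 z, P (y, s) :=
  (Continuous.prodMk_left s).continuousAt.eventually h

theorem fderiv_fderiv_slice [NormedSpace ℝ G] {u : G × ℝ → ℝ} {z : G} {s : ℝ}
    (hu : ContDiffAt ℝ 2 u (z, s)) (v : G) :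
    fderiv ℝ (fderiv ℝ fun y => u (y, s)) z v v =
      fderiv ℝ (fun p => fderiv ℝ u p (v, 0)) (z, s) (v, 0) := by
  have hc : ContDiffAt ℝ 2 (fun y => u (y, s)) z :=
    ContDiffAt.comp (g := u) (f := fun y => (y, s)) z hu (contDiffAt_id.prodMk contDiffAt_const)
  have hev : (fun y => fderiv ℝ (fun y => u (y, s)) y v) =ᶠ[𝓝 z]
      fun y => fderiv ℝ u (y, s) (v, 0) := by
    filter_upwards [eventually_slice (hu.eventually (by simp))] with y hy
    exact fderiv_slice (hy.differentiableAt (by norm_num)) v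
  rw [fderiv_fderiv_apply hc, hev.fderiv_eq]
  exact fderiv_slice (u := fun p => fderiv ℝ u p (v, 0))
    ((contDiffAt_fderiv_apply hu (m := 1) (by norm_num) (v, 0)).differentiableAt (by norm_num)) v

/-- The limit is one-sided because the inequality will be available only on the side `s > 0`. -/
theorem tendsto_inv_mul_param [NormedSpace ℝ G] {k : G × ℝ → ℝ} {z : G}
    (hk : DifferentiableAt ℝ k (z, 0)) (h0 : k (z, 0) = 0) :
    Tendsto (fun s : ℝ => s⁻¹ * k (z, s)) (𝓝[>] 0) (𝓝 (fderiv ℝ k (z, 0) (0, 1))) := by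
  have h1 : HasDerivAt (fun s : ℝ => ((z, s) : G × ℝ)) (0, 1) 0 :=
    (hasDerivAt_const _ _).prodMk (hasDerivAt_id _)
  have h2 : HasDerivAt (fun s : ℝ => k (z, s)) (fderiv ℝ k (z, 0) (0, 1)) 0 :=
    hk.hasFDerivAt.comp_hasDerivAt (0 : ℝ) h1
  have h3 := (hasDerivAt_iff_tendsto_slope_zero.1 h2).mono_left
    (nhdsWithin_mono (0 : ℝ) (s := Set.Ioi 0) fun x hx => ne_of_gt hx)
  simpa [h0] using h3

theorem tendsto_inv_mul_fderiv_slice [NormedSpace ℝ G] {u : G × ℝ → ℝ} {z : G}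
    (hu : ContDiffAt ℝ 2 u (z, 0)) (h0 : ∀ᶠ y in 𝓝 z, u (y, 0) = 0) (v : G) :
    Tendsto (fun s : ℝ => s⁻¹ * fderiv ℝ (fun y => u (y, s)) z v) (𝓝[>] 0)
      (𝓝 (fderiv ℝ (fun y => fderiv ℝ u (y, 0) (0, 1)) z v)) := by
  have hd := contDiffAt_fderiv_apply hu (m := 1) (by norm_num) (v, 0)
  have he := contDiffAt_fderiv_apply hu (m := 1) (by norm_num) (0, 1)
  have hz : (fun y => u (y, 0)) =ᶠ[𝓝 z] fun _ => 0 := h0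
  have key := tendsto_inv_mul_param (hd.differentiableAt (by norm_num)) (by
    rw [← fderiv_slice (hu.differentiableAt (by norm_num)), hz.fderiv_eq]; simp)
  have heq : fderiv ℝ (fun p => fderiv ℝ u p (v, 0)) (z, 0) (0, 1) =
      fderiv ℝ (fun y => fderiv ℝ u (y, 0) (0, 1)) z v := by
    rw [fderiv_slice (u := fun p => fderiv ℝ u p (0, 1)) (he.differentiableAt (by norm_num)),
      ← fderiv_fderiv_apply hu, ← fderiv_fderiv_apply hu, fderiv_fderiv_comm hu]
  rw [heq] at key
  refine key.congr' ?_
  have hc : Tendsto (fun s : ℝ => (z, s)) (𝓝[>] 0) (𝓝 (z, 0)) :=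
    ((Continuous.prodMk_right z).tendsto 0).mono_left nhdsWithin_le_nhds
  filter_upwards [hc.eventually (hu.eventually (by simp))] with s hs
  rw [fderiv_slice (hs.differentiableAt (by norm_num))]

/-- Difference quotient of `∂_v ∂_v u`, which vanishes at `s = 0` because `u` does; commuting
partials then moves `∂_s` inside. Three derivatives of `u` are used here, whence the `C³`
regularity. -/
theorem tendsto_inv_mul_fderiv_fderiv_slice [NormedSpace ℝ G] {u : G × ℝ → ℝ} {z : G}
    (hu : ContDiffAt ℝ 3 u (z, 0)) (h0 : ∀ᶠ y in 𝓝 z, u (y, 0) = 0) (v : G) :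
    Tendsto (fun s : ℝ => s⁻¹ * fderiv ℝ (fderiv ℝ fun y => u (y, s)) z v v) (𝓝[>] 0)
      (𝓝 (fderiv ℝ (fderiv ℝ fun y => fderiv ℝ u (y, 0) (0, 1)) z v v)) := by
  have hu2 : ContDiffAt ℝ 2 u (z, 0) := hu.of_le (by norm_num)
  have hv := contDiffAt_fderiv_apply hu (m := 2) (by norm_num) (v, 0)
  have he := contDiffAt_fderiv_apply hu (m := 2) (by norm_num) (0, 1)
  have hvv := contDiffAt_fderiv_apply hv (m := 1) (by norm_num) (v, 0)
  have hz : (fun y => u (y, 0)) =ᶠ[𝓝 z] fun _ => 0 := h0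
  have key := tendsto_inv_mul_param (hvv.differentiableAt (by norm_num)) (by
    rw [← fderiv_fderiv_slice hu2, hz.fderiv.fderiv_eq]; simp)
  have hev : (fun p => fderiv ℝ (fun p => fderiv ℝ u p (v, 0)) p (0, 1)) =ᶠ[𝓝 (z, 0)]
      fun p => fderiv ℝ (fun p => fderiv ℝ u p (0, 1)) p (v, 0) := by
    filter_upwards [hu2.eventually (by simp)] with p hp
    rw [← fderiv_fderiv_apply hp, ← fderiv_fderiv_apply hp, fderiv_fderiv_comm hp]
  have heq : fderiv ℝ (fun p => fderiv ℝ (fun p => fderiv ℝ u p (v, 0)) p (v, 0)) (z, 0) (0, 1) =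
      fderiv ℝ (fderiv ℝ fun y => fderiv ℝ u (y, 0) (0, 1)) z v v := by
    rw [fderiv_fderiv_slice (u := fun p => fderiv ℝ u p (0, 1)) he,
      ← hev.fderiv_eq, ← fderiv_fderiv_apply hv, ← fderiv_fderiv_apply hv, fderiv_fderiv_comm hv]
  rw [heq] at key
  refine key.congr' ?_
  have hc : Tendsto (fun s : ℝ => (z, s)) (𝓝[>] 0) (𝓝 (z, 0)) :=
    ((Continuous.prodMk_right z).tendsto 0).mono_left nhdsWithin_le_nhds
  filter_upwards [hc.eventually (hu2.eventually (by simp))] with s hs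
  rw [fderiv_fderiv_slice hs]

end Calculus


/-! ### The boundary limit along a family of holomorphic discs. -/

section Disc

theorem fderiv_real_I_smul {G E : Type*} [NormedAddCommGroup G] [NormedSpace ℂ G]
    [NormedAddCommGroup E] [NormedSpace ℂ E] {Φ : G → E} {z : G}
    (h : DifferentiableAt ℂ Φ z) (v : G) :
    fderiv ℝ Φ z (Complex.I • v) = Complex.I • fderiv ℝ Φ z v := by
  rw [(h.hasFDerivAt.restrictScalars ℝ).fderiv]
  simp

theorem fderiv_real_one {E : Type*} [NormedAddCommGroup E] [NormedSpace ℂ E] {Φ : ℂ → E} {z : ℂ}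
    (h : DifferentiableAt ℂ Φ z) : fderiv ℝ Φ z 1 = deriv Φ z := by
  rw [(h.hasFDerivAt.restrictScalars ℝ).fderiv]
  simp

/-- The factor `k z ^ η` is pulled out so that it cancels against `δ^η g`; what remains depends only
on quotients by `k z` that have limits at the boundary. -/
theorem leviForm_neg_rpow {G : Type*} [NormedAddCommGroup G] [NormedSpace ℂ G] {k : G → ℝ} {z : G}
    (hk : ContDiffAt ℝ 2 k z) (hpos : 0 < k z) (η : ℝ) (v : G) :
    leviForm (fun y => -(k y ^ η)) z v = k z ^ η * (-η * (leviForm k z v / k z) + η * (1 - η) *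
      (((fderiv ℝ k z v / k z) ^ 2 + (fderiv ℝ k z (Complex.I • v) / k z) ^ 2) / 4)) := by
  have h1 : ∀ᶠ x in 𝓝 (k z), HasDerivAt (fun x : ℝ => -(x ^ η)) (-(η * x ^ (η - 1))) x := by
    filter_upwards [lt_mem_nhds hpos] with x hx
    exact (Real.hasDerivAt_rpow_const (Or.inl hx.ne')).neg
  have h2 : HasDerivAt (fun x : ℝ => -(η * x ^ (η - 1)))
      (-(η * ((η - 1) * k z ^ (η - 1 - 1)))) (k z) :=
    ((Real.hasDerivAt_rpow_const (Or.inl hpos.ne')).const_mul η).neg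
  rw [leviForm_comp_real hk h1 h2, Real.rpow_sub_one hpos.ne' (η - 1),
    Real.rpow_sub_one hpos.ne' η]
  field_simp
  ring

theorem leviForm_neg_log {G : Type*} [NormedAddCommGroup G] [NormedSpace ℂ G] {k : G → ℝ} {z : G}
    (hk : ContDiffAt ℝ 2 k z) (hpos : 0 < k z) (v : G) :
    leviForm (fun y => -Real.log (k y)) z v = -(leviForm k z v / k z) +
      ((fderiv ℝ k z v / k z) ^ 2 + (fderiv ℝ k z (Complex.I • v) / k z) ^ 2) / 4 := by
  have h1 : ∀ᶠ x in 𝓝 (k z), HasDerivAt (fun x : ℝ => -Real.log x) (-x⁻¹) x := by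
    filter_upwards [lt_mem_nhds hpos] with x hx
    exact (Real.hasDerivAt_log hx.ne').neg
  have h2 : HasDerivAt (fun x : ℝ => -x⁻¹) (-(-(k z ^ 2)⁻¹)) (k z) :=
    (hasDerivAt_inv hpos.ne').neg
  rw [leviForm_comp_real hk h1 h2]
  field_simp

/-- Let `a` be a holomorphic disc in the zero set of `f`, and let `b` be a holomorphic vector field
along `a` which points into `{f > 0}`. If `i∂∂̄(-f^η) ≥ f^η Q` holds at the points `a 0 + s b 0`
with small `s > 0`, then `-log (df(b))` has Levi form at least `Q` along `a`. -/
theorem le_leviForm_neg_log_of_disc {E : Type*} [NormedAddCommGroup E] [NormedSpace ℂ E]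
    [CompleteSpace E] {f : E → ℝ} {a b : ℂ → E} {Q : E → E → ℝ} {η : ℝ} (hη0 : 0 < η) (hη1 : η < 1)
    (ha : AnalyticAt ℂ a 0) (hb : AnalyticAt ℂ b 0) (hf : ContDiffAt ℝ 3 f (a 0))
    (h0 : ∀ᶠ z in 𝓝 0, f (a z) = 0) (hpos : 0 < fderiv ℝ f (a 0) (b 0))
    (hQ : ContinuousAt (fun p : E × E => Q p.1 p.2) (a 0, deriv a 0))
    (hQ0 : 0 ≤ Q (a 0) (deriv a 0))
    (hin : ∀ᶠ s : ℝ in 𝓝[>] 0, ∀ v, f (a 0 + s • b 0) ^ η * Q (a 0 + s • b 0) v ≤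
      leviForm (fun y => -(f y ^ η)) (a 0 + s • b 0) v) :
    Q (a 0) (deriv a 0) ≤ leviForm (fun z => -Real.log (fderiv ℝ f (a z) (b z))) 0 1 := by
  set u : ℂ × ℝ → ℝ := fun p => f (a p.1 + p.2 • b p.1) with hu_def
  have haR : ContDiffAt ℝ 3 a 0 := ha.contDiffAt.restrict_scalars ℝ
  have hbR : ContDiffAt ℝ 3 b 0 := hb.contDiffAt.restrict_scalars ℝ
  have hΨ : ContDiffAt ℝ 3 (fun p : ℂ × ℝ => a p.1 + p.2 • b p.1) (0, 0) :=
    (ContDiffAt.comp (g := a) (f := Prod.fst) (0, 0) haR contDiffAt_fst).add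
      (contDiffAt_snd.smul (ContDiffAt.comp (g := b) (f := Prod.fst) (0, 0) hbR contDiffAt_fst))
  have hu : ContDiffAt ℝ 3 u (0, 0) :=
    ContDiffAt.comp (g := f) (f := fun p : ℂ × ℝ => a p.1 + p.2 • b p.1) (0, 0)
      (by simpa using hf) hΨ
  have hu2 : ContDiffAt ℝ 2 u (0, 0) := hu.of_le (by norm_num)
  have hu0 : ∀ᶠ z in 𝓝 0, u (z, 0) = 0 := by simpa [hu_def] using h0
  -- Both sides are the derivative of `s ↦ f (a z + s • b z)` at `0`.
  have hH : (fun z => fderiv ℝ f (a z) (b z)) =ᶠ[𝓝 0] fun z => fderiv ℝ u (z, 0) (0, 1) := by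
    filter_upwards [ha.continuousAt.eventually (hf.eventually (by simp)),
      eventually_slice (hu.eventually (by simp))] with z hz huz
    have hc : HasDerivAt (fun s : ℝ => ((z, s) : ℂ × ℝ)) (0, 1) 0 :=
      (hasDerivAt_const _ _).prodMk (hasDerivAt_id _)
    have h1 : HasDerivAt (fun s : ℝ => u (z, s)) (fderiv ℝ u (z, 0) (0, 1)) 0 :=
      (huz.differentiableAt (by norm_num)).hasFDerivAt.comp_hasDerivAt (0 : ℝ) hc
    have h2 : HasDerivAt (fun s : ℝ => a z + s • b z) (b z) 0 := by
      simpa using ((hasDerivAt_id (0 : ℝ)).smul_const (b z)).const_add (a z)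
    have h3 : HasDerivAt (fun s : ℝ => f (a z + s • b z)) (fderiv ℝ f (a z) (b z)) 0 := by
      have hfz : HasFDerivAt f (fderiv ℝ f (a z)) (a z + (0 : ℝ) • b z) := by
        simpa using (hz.differentiableAt (by norm_num)).hasFDerivAt
      exact hfz.comp_hasDerivAt (0 : ℝ) h2
    exact h3.unique h1
  set h : ℂ → ℝ := fun z => fderiv ℝ u (z, 0) (0, 1) with hh_def
  have hh0 : 0 < h 0 := by rw [← hH.self_of_nhds]; exact hpos
  have hh2 : ContDiffAt ℝ 2 h 0 :=
    ContDiffAt.comp (g := fun p => fderiv ℝ u p (0, 1)) (f := fun z : ℂ => (z, (0 : ℝ))) 0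
      (contDiffAt_fderiv_apply hu (by norm_num) (0, 1)) (contDiffAt_id.prodMk contDiffAt_const)
  have t0 : Tendsto (fun s : ℝ => s⁻¹ * u (0, s)) (𝓝[>] 0) (𝓝 (h 0)) :=
    tendsto_inv_mul_param (hu.differentiableAt (by norm_num)) hu0.self_of_nhds
  have t1 := tendsto_inv_mul_fderiv_slice hu2 hu0
  have t2 := tendsto_inv_mul_fderiv_fderiv_slice hu hu0
  have hupos : ∀ᶠ s : ℝ in 𝓝[>] 0, 0 < u (0, s) := by
    filter_upwards [t0.eventually (lt_mem_nhds hh0), self_mem_nhdsWithin] with s hs hs0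
    exact (mul_pos_iff_of_pos_left (inv_pos.2 hs0)).1 hs
  have tL : Tendsto (fun s : ℝ => leviForm (fun z => u (z, s)) 0 1 / u (0, s)) (𝓝[>] 0)
      (𝓝 (leviForm h 0 1 / h 0)) := by
    have := (((t2 1).add (t2 (Complex.I • 1))).div_const 4).div t0 hh0.ne'
    refine this.congr' ?_
    filter_upwards [self_mem_nhdsWithin, hupos] with s (hs : 0 < s) hus
    simp only [Pi.div_apply]
    unfold leviForm
    field_simp
  have tD : ∀ v, Tendsto (fun s : ℝ => fderiv ℝ (fun z => u (z, s)) 0 v / u (0, s)) (𝓝[>] 0)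
      (𝓝 (fderiv ℝ h 0 v / h 0)) := by
    intro v
    refine ((t1 v).div t0 hh0.ne').congr' ?_
    filter_upwards [self_mem_nhdsWithin, hupos] with s (hs : 0 < s) hus
    simp only [Pi.div_apply]
    field_simp
  have tR := (tL.const_mul (-η)).add
    (((((tD 1).pow 2).add ((tD (Complex.I • 1)).pow 2)).div_const 4).const_mul (η * (1 - η)))
  have hcurve : Tendsto (fun s : ℝ => (a 0 + s • b 0, deriv a 0 + s • deriv b 0)) (𝓝[>] 0)
      (𝓝 (a 0, deriv a 0)) := by
    have : Continuous fun s : ℝ => (a 0 + s • b 0, deriv a 0 + s • deriv b 0) := by fun_prop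
    simpa using (this.tendsto 0).mono_left (nhdsWithin_le_nhds (s := Set.Ioi 0))
  -- The hypothesis, tested on the velocity of the disc `z ↦ a z + s • b z`, is divided by `u (0, s)
  -- ^ η > 0`, and then `s → 0⁺`.
  have hle : Q (a 0) (deriv a 0) ≤ -η * (leviForm h 0 1 / h 0) + η * (1 - η) *
      (((fderiv ℝ h 0 1 / h 0) ^ 2 + (fderiv ℝ h 0 (Complex.I • 1) / h 0) ^ 2) / 4) := by
    refine le_of_tendsto_of_tendsto (hQ.tendsto.comp hcurve) tR ?_
    have hcf : Tendsto (fun s : ℝ => a 0 + s • b 0) (𝓝[>] 0) (𝓝 (a 0)) :=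
      (continuous_fst.tendsto _).comp hcurve
    have hcs : Tendsto (fun s : ℝ => ((0 : ℂ), s)) (𝓝[>] 0) (𝓝 (0, 0)) :=
      ((Continuous.prodMk_right (0 : ℂ)).tendsto 0).mono_left nhdsWithin_le_nhds
    filter_upwards [hin, hupos, hcf.eventually (hf.eventually (by simp)),
      hcs.eventually (hu2.eventually (by simp))] with s hs hus hfs hus2
    have hΦ : AnalyticAt ℂ (fun z => a z + (s : ℂ) • b z) 0 :=
      ha.add (analyticAt_const.smul hb)
    have hder : fderiv ℝ (fun z => a z + s • b z) 0 1 = deriv a 0 + s • deriv b 0 := by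
      have h1 : HasDerivAt (fun z => a z + (s : ℂ) • b z) (deriv a 0 + (s : ℂ) • deriv b 0) 0 :=
        ha.differentiableAt.hasDerivAt.add (hb.differentiableAt.hasDerivAt.const_smul (s : ℂ))
      simpa only [Complex.coe_smul] using (fderiv_real_one h1.differentiableAt).trans h1.deriv
    have hfr : ContDiffAt ℝ 2 (fun y => -(f y ^ η)) (a 0 + s • b 0) :=
      ((hfs.of_le (by norm_num)).rpow_const_of_ne hus.ne').neg
    have hlev := leviForm_comp_holomorphic (f := fun y => -(f y ^ η))
      (Φ := fun z => a z + s • b z) (z := 0) hfr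
      (by simpa using (hΦ.contDiffAt (n := 2)).restrict_scalars ℝ)
      (by
        filter_upwards [hΦ.eventually_analyticAt] with z hz v
        simpa using fderiv_real_I_smul hz.differentiableAt v) 1
    have hus2' : ContDiffAt ℝ 2 (fun z => u (z, s)) 0 :=
      ContDiffAt.comp (g := u) (f := fun z : ℂ => (z, s)) 0 hus2
        (contDiffAt_id.prodMk contDiffAt_const)
    have key := hs (deriv a 0 + s • deriv b 0)
    rw [hder] at hlev
    rw [← hlev] at key
    have h3 := leviForm_neg_rpow hus2' hus η 1
    rw [show leviForm (fun y => -(f (a y + s • b y) ^ η)) 0 1 = _ from h3] at key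
    exact le_of_mul_le_mul_left key (Real.rpow_pos_of_pos hus η)
  have hcongr : (fun z => -Real.log (fderiv ℝ f (a z) (b z))) =ᶠ[𝓝 0] fun z => -Real.log (h z) :=
    hH.fun_comp fun x => -Real.log x
  rw [leviForm_congr hcongr, leviForm_neg_log hh2 hh0]
  have hB : 0 ≤ ((fderiv ℝ h 0 1 / h 0) ^ 2 + (fderiv ℝ h 0 (Complex.I • 1) / h 0) ^ 2) / 4 := by
    positivity
  generalize ((fderiv ℝ h 0 1 / h 0) ^ 2 + (fderiv ℝ h 0 (Complex.I • 1) / h 0) ^ 2) / 4 = B at *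
  generalize leviForm h 0 1 / h 0 = A at *
  generalize Q (a 0) (deriv a 0) = q at *
  -- The term dropped from `hle` is `-η² B ≤ 0`. Next `0 ≤ q` forces `-A + B ≥ 0`, and `η < 1`
  -- removes the factor `η`.
  have h1 : q ≤ η * (-A + B) := by nlinarith [mul_nonneg (sq_nonneg η) hB]
  have h2 : 0 ≤ -A + B := by
    by_contra hneg
    nlinarith [mul_pos hη0 (neg_pos.2 (not_le.1 hneg))]
  nlinarith

end Disc


/-! ### Transfer between the manifold and one fixed holomorphic chart. -/

section Charts

theorem differentiableAt_complex_of_real {G E : Type*} [NormedAddCommGroup G] [NormedSpace ℂ G]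
    [NormedAddCommGroup E] [NormedSpace ℂ E] {Φ : G → E} {z : G} (h : DifferentiableAt ℝ Φ z)
    (hI : ∀ v, fderiv ℝ Φ z (Complex.I • v) = Complex.I • fderiv ℝ Φ z v) :
    DifferentiableAt ℂ Φ z := by
  refine (differentiableAt_iff_restrictScalars ℝ h).2 ⟨⟨{
    toFun := fderiv ℝ Φ z
    map_add' := map_add _
    map_smul' := fun c v => ?_ }, (fderiv ℝ Φ z).continuous⟩, rfl⟩
  have hr : ∀ (r : ℝ) (v : G), fderiv ℝ Φ z ((r : ℂ) • v) = (r : ℂ) • fderiv ℝ Φ z v := by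
    intro r v
    simp [Complex.coe_smul]
  have hc : c • v = (c.re : ℂ) • v + (c.im : ℂ) • Complex.I • v := by
    rw [smul_smul, ← add_smul, Complex.re_add_im]
  rw [RingHom.id_apply, hc, map_add, hr, hr, hI, smul_smul, ← add_smul, Complex.re_add_im]

variable {E : Type*} [NormedAddCommGroup E] [NormedSpace ℂ E]
  {X : Type*} [TopologicalSpace X] [ChartedSpace E X]

theorem contDiffAt_transition [IsManifold 𝓘(ℂ, E) ω X] (p x : X) {y : E}
    (hy : y ∈ (chartAt E p).target) (hx : (chartAt E p).symm y ∈ (chartAt E x).source) :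
    ContDiffAt ℂ ω (fun z => chartAt E x ((chartAt E p).symm z)) y := by
  have h := (contDiffGroupoid ω 𝓘(ℂ, E)).compatible (chart_mem_atlas E p) (chart_mem_atlas E x)
  rw [contDiffGroupoid, mem_groupoid_of_pregroupoid] at h
  have h1 : ContDiffOn ℂ ω (fun z => chartAt E x ((chartAt E p).symm z))
      ((chartAt E p).symm.trans (chartAt E x)).source := by
    simpa [contDiffPregroupoid, Function.comp_def] using h.1
  exact h1.contDiffAt (((chartAt E p).symm.trans (chartAt E x)).open_source.mem_nhds
    (by simp [hy, hx]))

/-- The differential of the inverse of the chart at `p`, as a map from the model space to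
`T_x X = E`, where `x` has the coordinate `y`. -/
noncomputable def chartDeriv (p : X) (y : E) : E →L[ℝ] E :=
  mfderiv 𝓘(ℝ, E) 𝓘(ℝ, E) (chartAt E p).symm y

/-- `T_x X` is identified with `E` by the preferred chart at `x`, so this differential is that of a
transition map. -/
theorem chartDeriv_eq [IsManifold 𝓘(ℂ, E) ω X] (p : X) {y : E} (hy : y ∈ (chartAt E p).target) :
    chartDeriv p y =
      fderiv ℝ (fun z => chartAt E ((chartAt E p).symm y) ((chartAt E p).symm z)) y := by
  have h : MDifferentiableAt 𝓘(ℝ, E) 𝓘(ℝ, E) (chartAt E p).symm y :=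
    mdifferentiableAt_atlas_symm (I := 𝓘(ℝ, E)) (chart_mem_atlas E p) hy
  unfold chartDeriv
  rw [h.mfderiv]
  simp [writtenInExtChartAt, Function.comp_def, chartAt_self_eq]

theorem chartDeriv_I_smul [IsManifold 𝓘(ℂ, E) ω X] (p : X) {y : E}
    (hy : y ∈ (chartAt E p).target) (v : E) :
    chartDeriv p y (Complex.I • v) = Complex.I • chartDeriv p y v := by
  rw [chartDeriv_eq p hy]
  exact fderiv_real_I_smul
    ((contDiffAt_transition p _ hy (mem_chart_source E _)).differentiableAt (by simp)) v

theorem chartDeriv_injective [IsManifold 𝓘(ℂ, E) ω X] (p : X) {y : E}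
    (hy : y ∈ (chartAt E p).target) : Function.Injective (chartDeriv p y) :=
  (mdifferentiable_of_mem_atlas (I := 𝓘(ℝ, E)) (chart_mem_atlas E p)).symm.mfderiv_injective hy

/-- Independence of the chart, by holomorphy of the transition maps. `mleviForm` uses a different
chart at every point, whereas the limit has to be taken in a single one. -/
theorem mleviForm_chartDeriv [IsManifold 𝓘(ℂ, E) ω X] (p : X) {u : X → ℝ} {y : E}
    (hy : y ∈ (chartAt E p).target)
    (hu : ContDiffAt ℝ 2 (fun z => u ((chartAt E p).symm z)) y) (v : E) :
    mleviForm u ((chartAt E p).symm y) (chartDeriv p y v) =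
      leviForm (fun z => u ((chartAt E p).symm z)) y v := by
  set x := (chartAt E p).symm y with hx
  set e := chartAt E p
  set c := chartAt E x
  have hxe : x ∈ e.source := e.map_target hy
  have hΦ : ContDiffAt ℂ ω (fun z => c (e.symm z)) y :=
    contDiffAt_transition p x hy (mem_chart_source E x)
  have hΦ' : ContDiffAt ℂ ω (fun z => e (c.symm z)) (c x) :=
    contDiffAt_transition x p (mem_chart_target E x) (by simpa [c, e] using hxe)
  have hcx : c.symm (c x) = x := c.left_inv (mem_chart_source E x)
  have hu' : ContDiffAt ℝ 2 (fun z => u (c.symm z)) (c x) := by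
    have h1 : ContDiffAt ℝ 2 (fun z => u (e.symm (e (c.symm z)))) (c x) :=
      ContDiffAt.comp (g := fun z => u (e.symm z)) (f := fun z => e (c.symm z)) (c x)
        (by rw [hcx, hx, e.right_inv hy]; exact hu)
        ((hΦ'.of_le (by simp)).restrict_scalars ℝ)
    refine h1.congr_of_eventuallyEq ?_
    have : ∀ᶠ z in 𝓝 (c x), c.symm z ∈ e.source :=
      (c.continuousAt_symm (mem_chart_target E x)).eventually
        (by rw [hcx]; exact e.open_source.mem_nhds hxe)
    filter_upwards [this] with z hz
    rw [e.left_inv hz]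
  have hev : (fun z => u (e.symm z)) =ᶠ[𝓝 y] fun z => u (c.symm (c (e.symm z))) := by
    have : ∀ᶠ z in 𝓝 y, e.symm z ∈ c.source :=
      (e.continuousAt_symm hy).eventually (c.open_source.mem_nhds (mem_chart_source E x))
    filter_upwards [this] with z hz
    rw [c.left_inv hz]
  rw [leviForm_congr hev, leviForm_comp_holomorphic (f := fun z => u (c.symm z))
    (Φ := fun z => c (e.symm z)) hu' ((hΦ.of_le (by simp)).restrict_scalars ℝ), chartDeriv_eq p hy]
  · rfl
  · filter_upwards [hΦ.eventually (by simp)] with z hz w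
    exact fderiv_real_I_smul (hz.differentiableAt (by simp)) w

theorem contDiffAt_comp_chart_symm [IsManifold 𝓘(ℂ, E) ω X] (p : X) {u : X → ℝ} {y : E} {n : ℕ}
    (hy : y ∈ (chartAt E p).target)
    (hu : ContMDiffAt 𝓘(ℝ, E) 𝓘(ℝ, ℝ) n u ((chartAt E p).symm y)) :
    ContDiffAt ℝ n (fun z => u ((chartAt E p).symm z)) y := by
  have h : ContMDiffAt 𝓘(ℝ, E) 𝓘(ℝ, E) n (chartAt E p).symm y :=
    ((contMDiffOn_chart_symm (I := 𝓘(ℝ, E)) (n := ω) (x := p)).of_le (by simp)).contMDiffAt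
      ((chartAt E p).open_target.mem_nhds hy)
  exact (hu.comp y h).contDiffAt

theorem dif_chartDeriv [IsManifold 𝓘(ℂ, E) ω X] (p : X) {u : X → ℝ} {y : E}
    (hy : y ∈ (chartAt E p).target)
    (hu : MDifferentiableAt 𝓘(ℝ, E) 𝓘(ℝ, ℝ) u ((chartAt E p).symm y)) (v : E) :
    dif u ((chartAt E p).symm y) (chartDeriv p y v) =
      fderiv ℝ (fun z => u ((chartAt E p).symm z)) y v := by
  have h : MDifferentiableAt 𝓘(ℝ, E) 𝓘(ℝ, E) (chartAt E p).symm y :=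
    mdifferentiableAt_atlas_symm (I := 𝓘(ℝ, E)) (chart_mem_atlas E p) hy
  have := mfderiv_comp y hu h
  rw [mfderiv_eq_fderiv] at this
  rw [show (fun z => u ((chartAt E p).symm z)) = u ∘ (chartAt E p).symm from rfl, this]
  rfl

theorem push_eq_chartDeriv [IsManifold 𝓘(ℂ, E) ω X] {F : Type*} [NormedAddCommGroup F]
    [NormedSpace ℂ F] (p : X) {φ : F × ℝ → X} {q : F × ℝ} (hq : φ q ∈ (chartAt E p).source)
    (hφ : MDifferentiableAt 𝓘(ℝ, F × ℝ) 𝓘(ℝ, E) φ q) (v : F × ℝ) :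
    push φ q v = chartDeriv p (chartAt E p (φ q)) (fderiv ℝ (fun r => chartAt E p (φ r)) q v) := by
  set e := chartAt E p
  have he : MDifferentiableAt 𝓘(ℝ, E) 𝓘(ℝ, E) e (φ q) :=
    mdifferentiableAt_atlas (I := 𝓘(ℝ, E)) (chart_mem_atlas E p) hq
  have he' : MDifferentiableAt 𝓘(ℝ, E) 𝓘(ℝ, E) e.symm (e (φ q)) :=
    mdifferentiableAt_atlas_symm (I := 𝓘(ℝ, E)) (chart_mem_atlas E p) (e.map_source hq)
  have h1 : MDifferentiableAt 𝓘(ℝ, F × ℝ) 𝓘(ℝ, E) (e ∘ φ) q := he.comp q hφ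
  have h2 := mfderiv_comp q he' h1
  have hev : e.symm ∘ e ∘ φ =ᶠ[𝓝 q] φ := by
    filter_upwards [hφ.continuousAt.eventually (e.open_source.mem_nhds hq)] with r hr
    exact e.left_inv hr
  rw [hev.mfderiv_eq, mfderiv_eq_fderiv] at h2
  unfold push
  rw [h2]
  rfl

/-- The preferred charts may jump from point to point, so continuity is obtained in the tangent
bundle: `g` is a continuous section and the tangent map of the fixed chart is continuous. -/
theorem HermitianMetric.continuousAt_sq_chartDeriv [IsManifold 𝓘(ℂ, E) ω X]
    (g : HermitianMetric E X) (p : X) {y v : E} (hy : y ∈ (chartAt E p).target) :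
    ContinuousAt (fun r : E × E => g.sq ((chartAt E p).symm r.1) (chartDeriv p r.1 r.2))
      (y, v) := by
  set e := chartAt E p
  have hs : ContMDiffOn 𝓘(ℝ, E) 𝓘(ℝ, E) ω e.symm e.target :=
    contMDiffOn_chart_symm (I := 𝓘(ℝ, E)) (x := p)
  have ht := hs.continuousOn_tangentMapWithin (by simp) e.open_target.uniqueMDiffOn
  have hsrc : e.target ×ˢ Set.univ ∈ 𝓝 (y, v) :=
    prod_mem_nhds (e.open_target.mem_nhds hy) univ_mem
  have hv : ContinuousAt (fun r : E × E =>
      Bundle.TotalSpace.mk' E (E := fun x : X => TangentSpace 𝓘(ℝ, E) x) (e.symm r.1)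
        (chartDeriv p r.1 r.2)) (y, v) := by
    have hc : Continuous fun r : E × E =>
        (Bundle.TotalSpace.mk' E (E := fun x : E => TangentSpace 𝓘(ℝ, E) x) r.1 r.2) :=
      (tangentBundleModelSpaceHomeomorph 𝓘(ℝ, E)).symm.continuous
    have h1 : ContinuousOn (fun r : E × E => tangentMapWithin 𝓘(ℝ, E) 𝓘(ℝ, E) e.symm e.target
        (Bundle.TotalSpace.mk' E (E := fun x : E => TangentSpace 𝓘(ℝ, E) x) r.1 r.2))
        (e.target ×ˢ Set.univ) :=
      ht.comp hc.continuousOn fun r hr => hr.1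
    refine (h1.continuousAt hsrc).congr ?_
    filter_upwards [hsrc] with r hr
    simp only [tangentMapWithin, chartDeriv]
    rw [mfderivWithin_of_isOpen e.open_target hr.1]
    rfl
  have hb : ContinuousAt (fun r : E × E => e.symm r.1) (y, v) :=
    ContinuousAt.comp (g := e.symm) (f := Prod.fst) (e.continuousAt_symm hy) continuousAt_fst
  have hg : ContinuousAt (fun r : E × E => Bundle.TotalSpace.mk' (E →L[ℝ] E →L[ℝ] ℝ)
      (E := fun x : X => TangentSpace 𝓘(ℝ, E) x →L[ℝ] TangentSpace 𝓘(ℝ, E) x →L[ℝ] ℝ)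
      (e.symm r.1) (g.inner (e.symm r.1))) (y, v) :=
    ContinuousAt.comp (g := fun x => Bundle.TotalSpace.mk' (E →L[ℝ] E →L[ℝ] ℝ)
      (E := fun x : X => TangentSpace 𝓘(ℝ, E) x →L[ℝ] TangentSpace 𝓘(ℝ, E) x →L[ℝ] ℝ) x
        (g.inner x)) g.contMDiff.continuous.continuousAt hb
  have h := ContinuousAt.clm_bundle_apply₂ (F₁ := E) (F₂ := E) (F₃ := ℝ)
    (E₃ := Bundle.Trivial X ℝ) hg hv hv
  simp only [FiberBundle.continuousAt_totalSpace] at h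
  exact h.2

end Charts


/-! ### Transversality and defining functions at the boundary. -/

section Boundary

/-- A real hyperplane of a complex vector space which contains the image of an injective real-linear
map `P : F × ℝ → E`, complex linear on `F`, does not contain `i P(0, 1)`, if `dim E = dim F + 1`. -/
theorem apply_I_smul_ne_zero {E F : Type*} [NormedAddCommGroup E] [NormedSpace ℂ E]
    [FiniteDimensional ℂ E] [NormedAddCommGroup F] [NormedSpace ℂ F] [FiniteDimensional ℂ F]
    (hdim : Module.finrank ℂ E = Module.finrank ℂ F + 1) {L : E →L[ℝ] ℝ} {P : F × ℝ →L[ℝ] E}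
    (hP : Function.Injective P) (hI : ∀ w, P (Complex.I • w, 0) = Complex.I • P (w, 0))
    (hL : L ≠ 0) (hLP : ∀ v, L (P v) = 0) : L (Complex.I • P (0, 1)) ≠ 0 := by
  intro h0
  have : FiniteDimensional ℝ E := FiniteDimensional.complexToReal E
  have : FiniteDimensional ℝ F := FiniteDimensional.complexToReal F
  have hle : P.toLinearMap.range ≤ L.toLinearMap.ker := by
    rintro _ ⟨v, rfl⟩
    exact hLP v
  have hL' : L.toLinearMap ≠ 0 := fun h => hL (by ext v; exact congrArg (fun l => l v) h)
  have h1 := Module.Dual.finrank_ker_add_one_of_ne_zero (f := L.toLinearMap) hL'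
  have h2 : Module.finrank ℝ P.toLinearMap.range = Module.finrank ℝ (F × ℝ) :=
    LinearMap.finrank_range_of_inj hP
  have h3 : Module.finrank ℝ (F × ℝ) = 2 * Module.finrank ℂ F + 1 := by
    rw [Module.finrank_prod, finrank_real_of_complex, Module.finrank_self]
  have h4 : Module.finrank ℝ E = 2 * Module.finrank ℂ E := finrank_real_of_complex E
  -- Both spaces have real dimension `2 dim F + 1`.
  have heq : P.toLinearMap.range = L.toLinearMap.ker :=
    Submodule.eq_of_le_of_finrank_eq hle (by omega)
  have hmem : Complex.I • P (0, 1) ∈ P.toLinearMap.range := by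
    rw [heq]; exact h0
  obtain ⟨⟨w, s⟩, hws⟩ := hmem
  have hsplit : ∀ (w : F) (s : ℝ), P (w, s) = P (w, 0) + s • P (0, 1) := by
    intro w s
    rw [← map_smul, ← map_add]; simp
  have hws' : Complex.I • P (0, 1) = P (w, 0) + s • P (0, 1) := by
    rw [← hsplit]; exact hws.symm
  -- Multiplying `i P(0, 1) = P(w, s)` by `i` again gives this; the real components then say `-1 =
  -- s²`.
  have h5 : P (0, -1) = P (Complex.I • w + s • w, s * s) := by
    have e1 : P (0, -1) = Complex.I • Complex.I • P (0, 1) := by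
      rw [smul_smul, Complex.I_mul_I, neg_one_smul, ← map_neg]; simp
    have e2 : P (Complex.I • w + s • w, s * s) =
        P (Complex.I • w, 0) + s • P (w, s) := by
      rw [← map_smul, ← map_add]; simp
    rw [e1, e2, hws', smul_add, hI, smul_comm, hws', hsplit w s]
  have h6 := congrArg Prod.snd (hP h5)
  simp only at h6
  nlinarith [mul_self_nonneg s]

theorem eq_zero_of_mem_frontier {X : Type*} [TopologicalSpace X] {Ω : Set X} (hΩ : IsOpen Ω)
    {k : X → ℝ} {x : X} (hx : x ∈ frontier Ω) (hk : ContinuousAt k x)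
    (hpos : ∀ᶠ y in 𝓝 x, y ∈ Ω → 0 < k y) (hx0 : 0 < k x → x ∈ Ω) : k x = 0 := by
  have hxΩ : x ∉ Ω := by
    rw [hΩ.frontier_eq] at hx; exact hx.2
  refine le_antisymm (not_lt.1 fun h => hxΩ (hx0 h)) ?_
  by_contra! hneg
  have hcl : x ∈ closure Ω := frontier_subset_closure hx
  obtain ⟨y, hy1, hy2, hy3⟩ := ((mem_closure_iff_frequently.1 hcl).and_eventually
    (hpos.and (hk.eventually (gt_mem_nhds hneg)))).exists
  exact absurd (hy2 hy1) (not_lt.2 hy3.le)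

theorem HasDerivAt.eventually_pos {k : ℝ → ℝ} {c : ℝ} (hk : HasDerivAt k c 0) (h0 : k 0 = 0)
    (hc : 0 < c) : ∀ᶠ s in 𝓝[>] 0, 0 < k s := by
  have h := (hasDerivAt_iff_tendsto_slope_zero.1 hk).mono_left
    (nhdsWithin_mono (0 : ℝ) (s := Set.Ioi 0) fun x hx => ne_of_gt hx)
  filter_upwards [h.eventually (lt_mem_nhds hc), self_mem_nhdsWithin] with s hs hs0
  simp only [zero_add, h0, sub_zero, smul_eq_mul] at hs
  exact (mul_pos_iff_of_pos_left (inv_pos.2 hs0)).1 hs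

theorem HasDerivAt.nonneg_of_eventually_pos {k : ℝ → ℝ} {c : ℝ} (hk : HasDerivAt k c 0)
    (h0 : k 0 = 0) (hpos : ∀ᶠ s in 𝓝[>] 0, 0 < k s) : 0 ≤ c := by
  have h := (hasDerivAt_iff_tendsto_slope_zero.1 hk).mono_left
    (nhdsWithin_mono (0 : ℝ) (s := Set.Ioi 0) fun x hx => ne_of_gt hx)
  refine ge_of_tendsto h ?_
  filter_upwards [hpos, self_mem_nhdsWithin] with s hs (hs0 : 0 < s)
  simp only [zero_add, h0, sub_zero, smul_eq_mul]
  positivity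

variable {E : Type*} [NormedAddCommGroup E] [NormedSpace ℂ E]
  {F : Type*} [NormedAddCommGroup F] [NormedSpace ℂ F]
  {X : Type*} [TopologicalSpace X] [ChartedSpace E X]

theorem IsBoundaryDistance.contMDiffAt {Ω : Set X} {δ : X → ℝ} (hδ : IsBoundaryDistance E Ω δ)
    {x : X} (hx : x ∈ closure Ω) : ContMDiffAt 𝓘(ℝ, E) 𝓘(ℝ, ℝ) 3 δ x := by
  obtain ⟨U, hU, hΩU, hs⟩ := hδ.smooth
  exact hs.contMDiffAt (hU.mem_nhds (hΩU hx))

theorem IsBoundaryDistance.eq_zero {Ω : Set X} (hΩ : IsOpen Ω) {δ : X → ℝ}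
    (hδ : IsBoundaryDistance E Ω δ) {x : X} (hx : x ∈ frontier Ω) : δ x = 0 := by
  have hcl := frontier_subset_closure hx
  exact eq_zero_of_mem_frontier hΩ hx (hδ.contMDiffAt hcl).continuousAt
    (Eventually.of_forall fun y hy => (hδ.pos_iff y (subset_closure hy)).1 hy)
    (hδ.pos_iff x hcl).2

/-- The sign of `δ` is controlled only on the closure of `Ω`. `ρ` detects `Ω` in a full
neighbourhood, which is what shows that a transverse ray enters `Ω`. -/
theorem exists_defining_function {Ω : Set X} (hΩ : IsOpen Ω) (h : HasLeviFlatBoundary E Ω)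
    {x : X} (hx : x ∈ frontier Ω) : ∃ ρ : X → ℝ, ContMDiffAt 𝓘(ℝ, E) 𝓘(ℝ, ℝ) 3 ρ x ∧
      dif (E := E) ρ x ≠ 0 ∧ (∀ᶠ y in 𝓝 x, y ∈ Ω ↔ 0 < ρ y) ∧
      ∀ᶠ y in 𝓝 x, y ∈ frontier Ω → ρ y = 0 := by
  obtain ⟨U, ρ, hU, hxU, hs, hd, hiff, -⟩ := h x hx
  refine ⟨ρ, hs.contMDiffAt (hU.mem_nhds hxU), hd x hxU, ?_, ?_⟩
  · filter_upwards [hU.mem_nhds hxU] with y hy using hiff y hy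
  · filter_upwards [hU.mem_nhds hxU] with y hy hyf
    refine eq_zero_of_mem_frontier hΩ hyf (hs.contMDiffAt (hU.mem_nhds hy)).continuousAt ?_
      (hiff y hy).2
    filter_upwards [hU.mem_nhds hy] with z hz using (hiff z hz).1

namespace IsFoliatedParam

variable {M : Set X} {V : Set (F × ℝ)} {φ : F × ℝ → X}

theorem contMDiffAt (hφ : IsFoliatedParam E M V φ) {q : F × ℝ} (hq : q ∈ V) :
    ContMDiffAt 𝓘(ℝ, F × ℝ) 𝓘(ℝ, E) 3 φ q :=
  hφ.smooth.contMDiffAt (hφ.isOpen.mem_nhds hq)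

theorem dif_push (hφ : IsFoliatedParam E M V φ) {q : F × ℝ} (hq : q ∈ V) {k : X → ℝ}
    (hk : ContMDiffAt 𝓘(ℝ, E) 𝓘(ℝ, ℝ) 3 k (φ q)) (h0 : ∀ᶠ x in 𝓝 (φ q), x ∈ M → k x = 0)
    (v : F × ℝ) : dif (E := E) k (φ q) (push φ q v) = 0 := by
  have hφq := hφ.contMDiffAt hq
  have h1 := mfderiv_comp q (hk.mdifferentiableAt (by norm_num))
    (hφq.mdifferentiableAt (by norm_num))
  have hev : k ∘ φ =ᶠ[𝓝 q] fun _ => 0 := by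
    filter_upwards [hφq.continuousAt.eventually h0, hφ.isOpen.mem_nhds hq] with r hr hrV
    exact hr (hφ.mapsTo hrV)
  rw [hev.mfderiv_eq, mfderiv_const] at h1
  exact (congrArg (fun l => l v) h1).symm

/-- Applied to `δ` it gives positivity of `h_δ`; applied to both `δ` and `ρ` it gives the inward
direction. -/
theorem dif_I_smul_push_ne_zero [FiniteDimensional ℂ E] [FiniteDimensional ℂ F]
    (hdim : Module.finrank ℂ E = Module.finrank ℂ F + 1)
    (hφ : IsFoliatedParam E M V φ) {q : F × ℝ} (hq : q ∈ V) {k : X → ℝ}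
    (hk : ContMDiffAt 𝓘(ℝ, E) 𝓘(ℝ, ℝ) 3 k (φ q)) (h0 : ∀ᶠ x in 𝓝 (φ q), x ∈ M → k x = 0)
    (hd : dif (E := E) k (φ q) ≠ 0) :
    dif (E := E) k (φ q) (Complex.I • push (E := E) φ q (0, 1)) ≠ 0 :=
  apply_I_smul_ne_zero hdim (P := push (E := E) φ q) (hφ.immersion q hq) (hφ.holomorphic q hq) hd
    (hφ.dif_push hq hk h0)

theorem eventually_mem (hφ : IsFoliatedParam E M V φ) (p : X) {q : F × ℝ} (hq : q ∈ V)
    (hp : φ q ∈ (chartAt E p).source) : ∀ᶠ r in 𝓝 q, r ∈ V ∧ φ r ∈ (chartAt E p).source :=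
  (hφ.isOpen.eventually_mem hq).and ((hφ.contMDiffAt hq).continuousAt.eventually
    ((chartAt E p).open_source.mem_nhds hp))

variable [IsManifold 𝓘(ℂ, E) ω X]

theorem contDiffAt_chart (hφ : IsFoliatedParam E M V φ) (p : X) {q : F × ℝ} (hq : q ∈ V)
    (hp : φ q ∈ (chartAt E p).source) : ContDiffAt ℝ 3 (fun r => chartAt E p (φ r)) q := by
  have h : ContMDiffAt 𝓘(ℝ, E) 𝓘(ℝ, E) 3 (chartAt E p) (φ q) :=
    ((contMDiffOn_chart (I := 𝓘(ℝ, E)) (n := ω) (x := p)).of_le (by simp)).contMDiffAt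
      ((chartAt E p).open_source.mem_nhds hp)
  exact (h.comp q (hφ.contMDiffAt hq)).contDiffAt

theorem fderiv_chart_I_smul (hφ : IsFoliatedParam E M V φ) (p : X) {q : F × ℝ} (hq : q ∈ V)
    (hp : φ q ∈ (chartAt E p).source) (w : F) :
    fderiv ℝ (fun r => chartAt E p (φ r)) q (Complex.I • w, 0) =
      Complex.I • fderiv ℝ (fun r => chartAt E p (φ r)) q (w, 0) := by
  have hmd := (hφ.contMDiffAt hq).mdifferentiableAt (by norm_num)
  have hy := (chartAt E p).map_source hp
  apply chartDeriv_injective p hy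
  rw [chartDeriv_I_smul p hy, ← push_eq_chartDeriv p hp hmd, ← push_eq_chartDeriv p hp hmd]
  exact hφ.holomorphic q hq w

theorem dif_I_smul_push (hφ : IsFoliatedParam E M V φ) (p : X) {q : F × ℝ} (hq : q ∈ V)
    (hp : φ q ∈ (chartAt E p).source) {k : X → ℝ}
    (hk : ContMDiffAt 𝓘(ℝ, E) 𝓘(ℝ, ℝ) 3 k (φ q)) (v : F × ℝ) :
    dif k (φ q) (Complex.I • push (E := E) φ q v) =
      fderiv ℝ (fun z => k ((chartAt E p).symm z)) (chartAt E p (φ q))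
        (Complex.I • fderiv ℝ (fun r => chartAt E p (φ r)) q v) := by
  have hmd := (hφ.contMDiffAt hq).mdifferentiableAt (by norm_num)
  have hy := (chartAt E p).map_source hp
  have hl := (chartAt E p).left_inv hp
  rw [push_eq_chartDeriv p hp hmd, ← chartDeriv_I_smul p hy, ← dif_chartDeriv p hy, hl]
  rw [hl]
  exact hk.mdifferentiableAt (by norm_num)

end IsFoliatedParam

end Boundary


/-! ### Complex lines in the slices of a foliated chart. -/

section Line

variable {E : Type*} [NormedAddCommGroup E] [NormedSpace ℂ E]
  {F : Type*} [NormedAddCommGroup F] [NormedSpace ℂ F]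

theorem tendsto_line (q : F × ℝ) (w : F) :
    Tendsto (fun z : ℂ => (q.1 + z • w, q.2)) (𝓝 0) (𝓝 q) := by
  have hc : Continuous fun z : ℂ => (q.1 + z • w, q.2) := by fun_prop
  simpa using hc.tendsto 0

theorem hasFDerivAt_comp_line {k : F × ℝ → E} {q : F × ℝ} {w : F} {z : ℂ}
    (hk : DifferentiableAt ℝ k (q.1 + z • w, q.2)) :
    HasFDerivAt (fun z : ℂ => k (q.1 + z • w, q.2))
      ((fderiv ℝ k (q.1 + z • w, q.2)).comp
        (((ContinuousLinearMap.id ℝ ℂ).smulRight w).prod (0 : ℂ →L[ℝ] ℝ))) z := by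
  have h : HasFDerivAt (fun z : ℂ => (q.1 + z • w, q.2))
      (((ContinuousLinearMap.id ℝ ℂ).smulRight w).prod (0 : ℂ →L[ℝ] ℝ)) z :=
    (((hasFDerivAt_id (𝕜 := ℝ) z).smul_const w).const_add q.1).prodMk (hasFDerivAt_const _ _)
  exact HasFDerivAt.comp (g := k) z hk.hasFDerivAt h

theorem analyticAt_comp_line [CompleteSpace E] {k : F × ℝ → E} {q : F × ℝ}
    (hk : ∀ᶠ r in 𝓝 q, DifferentiableAt ℝ k r ∧
      ∀ w, fderiv ℝ k r (Complex.I • w, 0) = Complex.I • fderiv ℝ k r (w, 0)) (w : F) :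
    AnalyticAt ℂ (fun z : ℂ => k (q.1 + z • w, q.2)) 0 := by
  rw [Complex.analyticAt_iff_eventually_differentiableAt]
  filter_upwards [(tendsto_line q w).eventually hk] with z hz
  have h := hasFDerivAt_comp_line hz.1
  refine differentiableAt_complex_of_real h.differentiableAt fun v => ?_
  rw [h.fderiv]
  simpa [smul_smul] using hz.2 (v • w)

theorem deriv_comp_line [CompleteSpace E] {k : F × ℝ → E} {q : F × ℝ}
    (hk : ∀ᶠ r in 𝓝 q, DifferentiableAt ℝ k r ∧
      ∀ w, fderiv ℝ k r (Complex.I • w, 0) = Complex.I • fderiv ℝ k r (w, 0)) (w : F) :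
    deriv (fun z : ℂ => k (q.1 + z • w, q.2)) 0 = fderiv ℝ k q (w, 0) := by
  have hq : (q.1 + (0 : ℂ) • w, q.2) = q := by simp
  rw [← fderiv_real_one (analyticAt_comp_line hk w).differentiableAt,
    (hasFDerivAt_comp_line (by rw [hq]; exact hk.self_of_nhds.1)).fderiv, hq]
  simp

/-- The transverse derivative of a family of holomorphic maps is holomorphic. -/
theorem eventually_fderiv_transverse {ψ : F × ℝ → E} {q : F × ℝ}
    (hψ : ∀ᶠ r in 𝓝 q, ContDiffAt ℝ 3 ψ r ∧
      ∀ w, fderiv ℝ ψ r (Complex.I • w, 0) = Complex.I • fderiv ℝ ψ r (w, 0)) :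
    ∀ᶠ r in 𝓝 q, DifferentiableAt ℝ (fun r => fderiv ℝ ψ r (0, 1)) r ∧
      ∀ w, fderiv ℝ (fun r => fderiv ℝ ψ r (0, 1)) r (Complex.I • w, 0) =
        Complex.I • fderiv ℝ (fun r => fderiv ℝ ψ r (0, 1)) r (w, 0) := by
  filter_upwards [hψ.eventually_nhds] with r hr
  have h3 := hr.self_of_nhds.1
  have h2 : ContDiffAt ℝ 2 ψ r := h3.of_le (by norm_num)
  have hd : ∀ v, DifferentiableAt ℝ (fun r => fderiv ℝ ψ r v) r := fun v =>
    (contDiffAt_fderiv_apply h2 (m := 1) (by norm_num) v).differentiableAt (by norm_num)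
  refine ⟨hd _, fun w => ?_⟩
  have hev : (fun r => fderiv ℝ ψ r (Complex.I • w, 0)) =ᶠ[𝓝 r]
      fun r => Complex.I • fderiv ℝ ψ r (w, 0) := hr.mono fun s hs => hs.2 w
  -- Symmetry of the second derivative puts the leaf direction inside, where the Cauchy–Riemann
  -- relation can be differentiated in `t`.
  rw [← fderiv_fderiv_apply h2, ← fderiv_fderiv_apply h2, fderiv_fderiv_comm h2,
    fderiv_fderiv_comm h2 (w, 0), fderiv_fderiv_apply h2, fderiv_fderiv_apply h2, hev.fderiv_eq,
    fderiv_fun_const_smul (hd _)]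
  rfl

end Line

/-! ### The induced normal metric and its curvature estimate. -/

section Main

variable {E : Type*} [NormedAddCommGroup E] [NormedSpace ℂ E]
  {F : Type*} [NormedAddCommGroup F] [NormedSpace ℂ F]
  {X : Type*} [TopologicalSpace X] [ChartedSpace E X] [IsManifold 𝓘(ℂ, E) ω X]
  {Ω : Set X} {δ : X → ℝ} {V : Set (F × ℝ)} {φ : F × ℝ → X}

theorem eventually_coeff_hMetric (hδ : IsBoundaryDistance E Ω δ)
    (hφ : IsFoliatedParam E (frontier Ω) V φ) (p : X) {q : F × ℝ} (hq : q ∈ V)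
    (hp : φ q ∈ (chartAt E p).source) :
    coeff (hMetric (E := E) δ) φ =ᶠ[𝓝 q] fun r =>
      |fderiv ℝ (fun z => δ ((chartAt E p).symm z)) (chartAt E p (φ r))
        (Complex.I • fderiv ℝ (fun r => chartAt E p (φ r)) r (0, 1))| := by
  filter_upwards [hφ.eventually_mem p hq hp] with r hr
  unfold coeff hMetric
  rw [hφ.dif_I_smul_push p hr.1 hr.2
    (hδ.contMDiffAt (frontier_subset_closure (hφ.mapsTo hr.1)))]

variable [FiniteDimensional ℂ E] [FiniteDimensional ℂ F]

theorem isNormalMetric_hMetric (hdim : Module.finrank ℂ E = Module.finrank ℂ F + 1)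
    (hΩ : IsOpen Ω) (hδ : IsBoundaryDistance E Ω δ) :
    IsNormalMetric F (frontier Ω) (hMetric (E := E) δ) := by
  intro V φ hφ
  have h3 : ∀ q ∈ V, ContMDiffAt 𝓘(ℝ, E) 𝓘(ℝ, ℝ) 3 δ (φ q) := fun q hq =>
    hδ.contMDiffAt (frontier_subset_closure (hφ.mapsTo hq))
  have h0 : ∀ q, ∀ᶠ x in 𝓝 (φ q), x ∈ frontier Ω → δ x = 0 := fun q =>
    Eventually.of_forall fun x hx => hδ.eq_zero hΩ hx
  have hne : ∀ q ∈ V, dif (E := E) δ (φ q) (Complex.I • push (E := E) φ q (0, 1)) ≠ 0 :=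
    fun q hq => hφ.dif_I_smul_push_ne_zero hdim hq (h3 q hq) (h0 q)
      (hδ.dif_ne_zero _ (hφ.mapsTo hq))
  refine ⟨fun q hq w s => ?_, fun q hq => abs_pos.2 (hne q hq), fun q hq => ?_⟩
  -- The leaf part drops out: `i φ_*(w, 0) = φ_*(i w, 0)` is tangent to the boundary and hence
  -- killed by `dδ`.
  · have hws : push (E := E) φ q (w, s) = push φ q (w, 0) + s • push φ q (0, 1) := by
      rw [← map_smul, ← map_add]; simp
    unfold coeff hMetric
    rw [hws, smul_add, ← hφ.holomorphic q hq, map_add, hφ.dif_push hq (h3 q hq) (h0 q), zero_add,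
      smul_comm, map_smul, smul_eq_mul, abs_mul]
  · have hp := mem_chart_source E (φ q)
    have hψ := hφ.contDiffAt_chart (φ q) hq hp
    have hf : ContDiffAt ℝ 3 (fun z => δ ((chartAt E (φ q)).symm z)) (chartAt E (φ q) (φ q)) :=
      contDiffAt_comp_chart_symm (n := 3) (φ q) (mem_chart_target E (φ q))
        (by rw [(chartAt E (φ q)).left_inv hp]; exact h3 q hq)
    have hsm : ContDiffAt ℝ 2 (fun r => fderiv ℝ (fun z => δ ((chartAt E (φ q)).symm z))
        (chartAt E (φ q) (φ r))
        (Complex.I • fderiv ℝ (fun r => chartAt E (φ q) (φ r)) r (0, 1))) q :=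
      (ContDiffAt.comp q (hf.fderiv_right (m := 2) (by norm_num))
        (hψ.of_le (by norm_num))).clm_apply
        ((contDiffAt_fderiv_apply hψ (m := 2) (by norm_num) (0, 1)).const_smul Complex.I)
    have hne' := hne q hq
    rw [hφ.dif_I_smul_push (φ q) hq hp (h3 q hq)] at hne'
    exact ((hsm.abs hne').congr_of_eventuallyEq
      (eventually_coeff_hMetric hδ hφ (φ q) hq hp)).contDiffWithinAt

theorem sq_push_le_chernCurvature [T2Space X]
    (hdim : Module.finrank ℂ E = Module.finrank ℂ F + 1)
    (hΩ : IsOpen Ω) (hflat : HasLeviFlatBoundary E Ω) (hδ : IsBoundaryDistance E Ω δ)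
    {η : ℝ} (hη0 : 0 < η) (hη1 : η < 1) {K : Set X} (hK : IsCompact K) (hKΩ : K ⊆ Ω)
    (g : HermitianMetric E X)
    (hpsh : ∀ x ∈ Ω \ K, ∀ v : E, δ x ^ η * g.sq x v ≤ mleviForm (fun y => -(δ y ^ η)) x v)
    (hφ : IsFoliatedParam E (frontier Ω) V φ) {q : F × ℝ} (hq : q ∈ V) (w : F) :
    g.sq (φ q) (push φ q (w, 0)) ≤ chernCurvature (hMetric (E := E) δ) φ q w := by
  have : CompleteSpace E := FiniteDimensional.complete ℂ E
  have hfr := hφ.mapsTo hq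
  have hδ3 := hδ.contMDiffAt (frontier_subset_closure hfr)
  obtain ⟨ρ, hρ3, hρd, hρΩ, hρ0⟩ := exists_defining_function hΩ hflat hfr
  set e := chartAt E (φ q)
  have hp : φ q ∈ e.source := mem_chart_source E (φ q)
  set ψ : F × ℝ → E := fun r => e (φ r) with hψ_def
  have hy : ψ q ∈ e.target := e.map_source hp
  have hleft : e.symm (ψ q) = φ q := e.left_inv hp
  have hmd := (hφ.contMDiffAt hq).mdifferentiableAt (by norm_num)
  have hψ : ∀ᶠ r in 𝓝 q, ContDiffAt ℝ 3 ψ r ∧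
      ∀ w, fderiv ℝ ψ r (Complex.I • w, 0) = Complex.I • fderiv ℝ ψ r (w, 0) := by
    filter_upwards [hφ.eventually_mem (φ q) hq hp] with r hr
    exact ⟨hφ.contDiffAt_chart _ hr.1 hr.2, hφ.fderiv_chart_I_smul _ hr.1 hr.2⟩
  have hψd : ∀ᶠ r in 𝓝 q, DifferentiableAt ℝ ψ r ∧
      ∀ w, fderiv ℝ ψ r (Complex.I • w, 0) = Complex.I • fderiv ℝ ψ r (w, 0) :=
    hψ.mono fun r hr => ⟨hr.1.differentiableAt (by norm_num), hr.2⟩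
  set f : E → ℝ := fun z => δ (e.symm z) with hf_def
  have hf : ContDiffAt ℝ 3 f (ψ q) := contDiffAt_comp_chart_symm (n := 3) (φ q) hy
    (by rw [show (chartAt E (φ q)).symm (ψ q) = φ q from hleft]; exact hδ3)
  have hρf : ContDiffAt ℝ 3 (fun z => ρ (e.symm z)) (ψ q) :=
    contDiffAt_comp_chart_symm (n := 3) (φ q) hy
      (by rw [show (chartAt E (φ q)).symm (ψ q) = φ q from hleft]; exact hρ3)
  set n : E := Complex.I • fderiv ℝ ψ q (0, 1) with hn
  have hδn : fderiv ℝ f (ψ q) n ≠ 0 := by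
    have := hφ.dif_I_smul_push_ne_zero hdim hq hδ3
      (Eventually.of_forall fun x hx => hδ.eq_zero hΩ hx) (hδ.dif_ne_zero _ hfr)
    rwa [hφ.dif_I_smul_push (φ q) hq hp hδ3] at this
  have hρn : fderiv ℝ (fun z => ρ (e.symm z)) (ψ q) n ≠ 0 := by
    have := hφ.dif_I_smul_push_ne_zero hdim hq hρ3 hρ0 hρd
    rwa [hφ.dif_I_smul_push (φ q) hq hp hρ3] at this
  -- The orientation of `t` is arbitrary, so `σ = ±1` is chosen to make `σ • n` point into `Ω`.
  obtain ⟨σ, hσ, hσρ⟩ : ∃ σ : ℝ, |σ| = 1 ∧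
      0 < fderiv ℝ (fun z => ρ (e.symm z)) (ψ q) (σ • n) := by
    rcases lt_or_gt_of_ne hρn with h | h
    · exact ⟨-1, by simp, by simpa using h⟩
    · exact ⟨1, by simp, by simpa using h⟩
  have hcurve : HasDerivAt (fun s : ℝ => ψ q + s • σ • n) (σ • n) 0 := by
    simpa using ((hasDerivAt_id (0 : ℝ)).smul_const (σ • n)).const_add (ψ q)
  have hcurve0 : ψ q + (0 : ℝ) • σ • n = ψ q := by simp
  have along : ∀ k : E → ℝ, ContDiffAt ℝ 3 k (ψ q) →
      HasDerivAt (fun s : ℝ => k (ψ q + s • σ • n)) (fderiv ℝ k (ψ q) (σ • n)) 0 := by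
    intro k hk
    have hk' : HasFDerivAt k (fderiv ℝ k (ψ q)) (ψ q + (0 : ℝ) • σ • n) := by
      rw [hcurve0]; exact (hk.differentiableAt (by norm_num)).hasFDerivAt
    exact hk'.comp_hasDerivAt (0 : ℝ) hcurve
  have hcont : Tendsto (fun s : ℝ => ψ q + s • σ • n) (𝓝[>] 0) (𝓝 (ψ q)) := by
    have := hcurve.continuousAt.tendsto
    rw [hcurve0] at this
    exact this.mono_left nhdsWithin_le_nhds
  have hcontX : Tendsto (fun s : ℝ => e.symm (ψ q + s • σ • n)) (𝓝[>] 0) (𝓝 (φ q)) := by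
    have := (e.continuousAt_symm hy).tendsto
    rw [hleft] at this
    exact this.comp hcont
  have hmemΩ : ∀ᶠ s : ℝ in 𝓝[>] 0, e.symm (ψ q + s • σ • n) ∈ Ω := by
    have hpos := HasDerivAt.eventually_pos (along _ hρf)
      (by rw [hcurve0, hleft]; exact hρ0.self_of_nhds hfr) hσρ
    filter_upwards [hpos, hcontX.eventually hρΩ] with s h1 h2
    exact h2.2 h1
  have hfpos : ∀ᶠ s : ℝ in 𝓝[>] 0, 0 < f (ψ q + s • σ • n) :=
    hmemΩ.mono fun s hs => (hδ.pos_iff _ (subset_closure hs)).1 hs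
  -- Positivity of `δ` on the ray gives only `≥ 0`; transversality excludes `0`.
  have hσδ : 0 < fderiv ℝ f (ψ q) (σ • n) := by
    refine lt_of_le_of_ne (HasDerivAt.nonneg_of_eventually_pos (along f hf)
      (by rw [hcurve0]; simp only [hf_def]; rw [hleft]; exact hδ.eq_zero hΩ hfr) hfpos) ?_
    rw [map_smul, smul_eq_mul]
    exact (mul_ne_zero (by rintro rfl; simp at hσ) hδn).symm
  have hnotK : ∀ᶠ s : ℝ in 𝓝[>] 0, e.symm (ψ q + s • σ • n) ∉ K := by
    have hqK : φ q ∉ K := fun h => by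
      rw [hΩ.frontier_eq] at hfr
      exact hfr.2 (hKΩ h)
    exact hcontX.eventually (hK.isClosed.isOpen_compl.mem_nhds hqK)
  set a : ℂ → E := fun z => ψ (q.1 + z • w, q.2) with ha_def
  set b : ℂ → E := fun z => σ • Complex.I • fderiv ℝ ψ (q.1 + z • w, q.2) (0, 1) with hb_def
  have ha0 : a 0 = ψ q := by simp [ha_def]
  have hb0 : b 0 = σ • n := by simp [hb_def, hn]
  have ha : AnalyticAt ℂ a 0 := analyticAt_comp_line hψd w
  have hb : AnalyticAt ℂ b 0 := by
    have h := analyticAt_comp_line (eventually_fderiv_transverse hψ) w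
    have h' : AnalyticAt ℂ (fun z : ℂ =>
        (σ : ℂ) • Complex.I • fderiv ℝ ψ (q.1 + z • w, q.2) (0, 1)) 0 :=
      analyticAt_const.smul (analyticAt_const.smul h)
    simpa only [Complex.coe_smul] using h'
  have hda : deriv a 0 = fderiv ℝ ψ q (w, 0) := deriv_comp_line hψd w
  have hpush : push φ q (w, 0) = chartDeriv (φ q) (ψ q) (fderiv ℝ ψ q (w, 0)) :=
    push_eq_chartDeriv (φ q) hp hmd (w, 0)
  have hmain := le_leviForm_neg_log_of_disc (f := f) (a := a) (b := b)
    (Q := fun y v => g.sq (e.symm y) (chartDeriv (φ q) y v)) hη0 hη1 ha hb (by rwa [ha0])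
    (by
      filter_upwards [(tendsto_line q w).eventually (hφ.eventually_mem (φ q) hq hp)] with z hz
      simp only [hf_def, ha_def, hψ_def]
      rw [e.left_inv hz.2]
      exact hδ.eq_zero hΩ (hφ.mapsTo hz.1))
    (by rw [ha0, hb0]; exact hσδ)
    (g.continuousAt_sq_chartDeriv (φ q) (by rw [ha0]; exact hy))
    (by
      -- The vector vanishes when `w = 0`, and `g.pos` needs a nonzero one.
      rcases eq_or_ne (chartDeriv (φ q) (a 0) (deriv a 0)) 0 with h | h
      · simp only [HermitianMetric.sq, h]
        exact (map_zero (g.inner (e.symm (a 0)) 0)).ge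
      · exact (g.pos _ _ h).le)
    (by
      rw [ha0, hb0]
      filter_upwards [hmemΩ, hnotK, hfpos, hcont.eventually (e.open_target.mem_nhds hy),
        hcont.eventually (hf.eventually (by simp))] with s h1 h2 h3 h4 h5 v
      have := hpsh _ ⟨h1, h2⟩ (chartDeriv (φ q) (ψ q + s • σ • n) v)
      rwa [mleviForm_chartDeriv (φ q) h4
        (((h5.of_le (by norm_num)).rpow_const_of_ne h3.ne').neg)] at this)
  simp only [ha0, hda] at hmain
  rw [hleft, ← hpush] at hmain
  refine hmain.trans_eq ?_
  set H : F → ℝ := fun z => -Real.log (coeff (hMetric (E := E) δ) φ (z, q.2))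
  set H' : F → ℝ := fun z => -Real.log (fderiv ℝ f (ψ (z, q.2))
    (σ • Complex.I • fderiv ℝ ψ (z, q.2) (0, 1)))
  have hHH' : H =ᶠ[𝓝 q.1] H' := by
    filter_upwards [(Continuous.prodMk_left q.2).continuousAt.eventually
      (eventually_coeff_hMetric hδ hφ (φ q) hq hp)] with z hz
    simp only [H, H']
    -- `Real.log` ignores signs, so `|σ| = 1` identifies the two logarithms.
    rw [hz, map_smul _ σ, smul_eq_mul, ← Real.log_abs (σ * _), abs_mul, hσ, one_mul]
  have hΦ : ∀ z : ℂ, HasFDerivAt (𝕜 := ℂ) (fun z : ℂ => q.1 + z • w)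
      ((ContinuousLinearMap.id ℂ ℂ).smulRight w) z := fun z =>
    ((hasFDerivAt_id z).smul_const w).const_add q.1
  have hH'2 : ContDiffAt ℝ 2 H' q.1 := by
    have hι : ContDiffAt ℝ 3 (fun z : F => (z, q.2)) q.1 := contDiffAt_id.prodMk contDiffAt_const
    have hψ3 : ContDiffAt ℝ 3 ψ (q.1, q.2) := hψ.self_of_nhds.1
    have h1 : ContDiffAt ℝ 2 (fun z : F => fderiv ℝ f (ψ (z, q.2))) q.1 :=
      ContDiffAt.comp (g := fderiv ℝ f) (f := fun z : F => ψ (z, q.2)) q.1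
        (hf.fderiv_right (m := 2) (by norm_num))
        ((ContDiffAt.comp (g := ψ) (f := fun z : F => (z, q.2)) q.1 hψ3 hι).of_le (by norm_num))
    have h2 : ContDiffAt ℝ 2 (fun z : F => fderiv ℝ ψ (z, q.2) (0, 1)) q.1 :=
      ContDiffAt.comp (g := fun r => fderiv ℝ ψ r (0, 1)) (f := fun z : F => (z, q.2)) q.1
        (contDiffAt_fderiv_apply hψ3 (by norm_num) _) (hι.of_le (by norm_num))
    exact ((h1.clm_apply ((h2.const_smul Complex.I).const_smul σ)).log hσδ.ne').neg
  -- Restriction to the complex line through `q.1` turns the direction `w` in `F` into the direction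
  -- `1` in `ℂ`.
  have hpull := leviForm_comp_holomorphic (f := H') (Φ := fun z : ℂ => q.1 + z • w) (z := 0)
    (by simpa using hH'2) (by fun_prop)
    (Eventually.of_forall fun z v => fderiv_real_I_smul (hΦ z).differentiableAt v) 1
  rw [((hΦ 0).restrictScalars ℝ).fderiv] at hpull
  unfold chernCurvature
  rw [leviForm_congr hHH']
  simpa using hpull

end Main

end LeviFlat

theorem proposition3p3
    {E : Type*} [NormedAddCommGroup E] [NormedSpace ℂ E] [FiniteDimensional ℂ E]
    {F : Type*} [NormedAddCommGroup F] [NormedSpace ℂ F] [FiniteDimensional ℂ F]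
    (hdim : Module.finrank ℂ E = Module.finrank ℂ F + 1)
    {X : Type*} [TopologicalSpace X] [T2Space X] [SecondCountableTopology X]
    [ChartedSpace E X] [IsManifold 𝓘(ℂ, E) ω X]
    (Ω : Set X) (hΩ_open : IsOpen Ω) (hΩ_conn : IsConnected Ω)
    (hΩ_compact : IsCompact (closure Ω))
    (hΩ_flat : LeviFlat.HasLeviFlatBoundary E Ω)
    (δ : X → ℝ) (hδ : LeviFlat.IsBoundaryDistance E Ω δ)
    (hδ_exp : 0 < LeviFlat.dfExponent E Ω δ) :
    LeviFlat.IsNormalMetric F (frontier Ω) (LeviFlat.hMetric (E := E) δ) ∧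
    (∃ g : LeviFlat.HermitianMetric E X,
      ∀ (V : Set (F × ℝ)) (φ : F × ℝ → X),
        LeviFlat.IsFoliatedParam E (frontier Ω) V φ →
        ∀ q ∈ V, ∀ w : F,
          g.sq (φ q) (LeviFlat.push φ q (w, 0)) ≤
            LeviFlat.chernCurvature (LeviFlat.hMetric (E := E) δ) φ q w) ∧
    LeviFlat.PositiveAlongLeaves E F (frontier Ω) := by
  -- Since `sSup ∅ = 0`, a positive exponent provides an admissible `η`.
  obtain ⟨η, hη0, hη1, K, g, hK, hKΩ, hpsh⟩ : {η : ℝ | 0 < η ∧ η < 1 ∧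
      LeviFlat.StrictlyPSHNearBoundary E Ω δ η}.Nonempty := by
    rw [Set.nonempty_iff_ne_empty]
    intro h
    simp [LeviFlat.dfExponent, h] at hδ_exp
  have hN := LeviFlat.isNormalMetric_hMetric (F := F) hdim hΩ_open hδ
  have hcurv : ∀ (V : Set (F × ℝ)) (φ : F × ℝ → X),
      LeviFlat.IsFoliatedParam E (frontier Ω) V φ → ∀ q ∈ V, ∀ w : F,
        g.sq (φ q) (LeviFlat.push φ q (w, 0)) ≤
          LeviFlat.chernCurvature (LeviFlat.hMetric (E := E) δ) φ q w :=
    fun V φ hφ q hq w => LeviFlat.sq_push_le_chernCurvature hdim hΩ_open hΩ_flat hδ hη0 hη1 hK hKΩ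
      g hpsh hφ hq w
  refine ⟨hN, ⟨g, hcurv⟩, _, hN, fun V φ hφ q hq w hw => lt_of_lt_of_le ?_ (hcurv V φ hφ q hq w)⟩
  -- Strict positivity: `φ` is an immersion, so `φ_*(w, 0) ≠ 0`.
  refine g.pos _ _ fun h => hw ?_
  have hinj := hφ.immersion q hq (a₁ := (w, 0)) (a₂ := 0) (h.trans (map_zero _).symm)
  exact congrArg Prod.fst hinj
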